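/- There is an absolute constant $K>0$ such that the following holds. Let $G=(V,E)$ be a finite simple hypergraph (every hyperedge is a subset of $V$, with no parallel copies) with $n$ vertices, $m$ hyperedges and rank $r\ge 2$, where the rank is the size of the largest hyperedge. A cut is a partition $(C,V\setminus C)$ of $V$ into two non-empty parts; its capacity is the number of hyperedges that intersect both parts; a min-cut is a cut of minimum capacity, and the connectivity $\lambda$ of $G$ is the capacity of a min-cut (so $n\ge 2$). Suppose $\lambda\ge r(4r^2)^r$. Then at least one of the following holds: 1. there is a min-cut $(C,V\setminus C)$ with $$\min\{|C|,|V\setminus C|\}\le r-\frac{\log\left(\frac{\lambda}{4r}\right)}{\log n};$$ 2. the number of hyperedges in the union of all min-cuts (that is, of hyperedges that cross at least one min-cut) is at most $$K\, r^{9r^2+2}\left(\frac{6r^2}{\lambda}\right)^{\frac1{r-1}} m\log n ,$$ and hence it is $\tilde O_r\!\left(m/\lambda^{1/(r-1)}\right)$, i.e. at most $h(r)\,\dfrac{m}{\lambda^{1/(r-1)}}\,(\log n)^k$ for a function $h$ of $r$ alone and an absolute exponent $k$. -/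

import Mathlib

namespace Hypergraph

/-- `H` has rank `r`: the largest size of a hyperedge of `H` is `r`. -/
def HasRank {V : Type*} (H : Hypergraph V) (r : ℕ) : Prop :=
  IsGreatest (Set.ncard '' H.edgeSet) r

/-- `(C, V \ C)` is a cut of `H`: a partition of the vertex set into two non-empty parts. -/
def IsCut {V : Type*} (H : Hypergraph V) (C : Set V) : Prop :=
  C ⊆ H.vertexSet ∧ C.Nonempty ∧ (H.vertexSet \ C).Nonempty

/-- The set `δ(C)` of the hyperedges that intersect both `C` and its complement in the vertex
set. -/
def cutEdges {V : Type*} (H : Hypergraph V) (C : Set V) : Set (Set V) :=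
  {e ∈ H.edgeSet | (e ∩ C).Nonempty ∧ (e ∩ (H.vertexSet \ C)).Nonempty}

/-- The capacity of `(C, V \ C)`: the number of hyperedges that cross it. -/
noncomputable def cutCapacity {V : Type*} (H : Hypergraph V) (C : Set V) : ℕ :=
  (H.cutEdges C).ncard

/-- A min-cut is a cut of minimum capacity among all cuts. -/
def IsMinCut {V : Type*} (H : Hypergraph V) (C : Set V) : Prop :=
  H.IsCut C ∧ ∀ D : Set V, H.IsCut D → H.cutCapacity C ≤ H.cutCapacity D

/-- `H` has connectivity `k`: the capacity of a min-cut of `H` is `k`. -/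
def HasConnectivity {V : Type*} (H : Hypergraph V) (k : ℕ) : Prop :=
  ∃ C : Set V, H.IsMinCut C ∧ H.cutCapacity C = k

/-- The size of the cut `(C, V \ C)`: the number of vertices on its smaller side. -/
noncomputable def cutSize {V : Type*} (H : Hypergraph V) (C : Set V) : ℕ :=
  min C.ncard (H.vertexSet \ C).ncard

/-- The union of all min-cuts: the set of the hyperedges that cross at least one min-cut. -/
def minCutEdges {V : Type*} (H : Hypergraph V) : Set (Set V) :=
  {e | ∃ C : Set V, H.IsMinCut C ∧ e ∈ H.cutEdges C}

end Hypergraph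

/-! Write k for the connectivity, n and m for the numbers of vertices and hyperedges. Singletons are
cuts, so every degree is at least k and a vertex set S carries degree sum at least |S|k; counting
hyperedges by rank bounds this sum above.

If a min-cut has a side C with fewer than r vertices, the count forces at least half of its k
hyperedges to contain C. At most n^(r-|C|) hyperedges do, which gives alternative 1
(`le_two_mul_pow_of_card_lt`).

Otherwise every side of a min-cut has at least L = (k/2)^(1/(r-1)) vertices, and a difference of two
sides has at most 4r or at least L. Fix a root vertex and represent each min-cut by the side
avoiding it. Uncrossing yields a laminar family F of min-cuts crossed by every hyperedge that
crosses any min-cut (`exists_laminar_separating`), and the size gap gives |F| L ≤ (8r+2)n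
(`laminar_card_mul_le`). The union thus has at most |F|k hyperedges, and nk ≤ rm gives a bound of
order r²m/L, without the factor log n. -/

namespace HypergraphMinCut

open Finset

section Finite

variable {α : Type*} [DecidableEq α]

/-! ### Degree counting and small min-cuts. -/

/-- The members of `E` that meet both `C` and its complement. -/
def boundary (E : Finset (Finset α)) (C : Finset α) : Finset (Finset α) :=
  {e ∈ E | (e ∩ C).Nonempty ∧ (e \ C).Nonempty}

theorem mem_boundary {E : Finset (Finset α)} {C e : Finset α} :
    e ∈ boundary E C ↔ e ∈ E ∧ (e ∩ C).Nonempty ∧ (e \ C).Nonempty := by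
  simp [boundary]

theorem card_powerset_filter_card_le (Y : Finset α) (k : ℕ) :
    #{s ∈ Y.powerset | #s ≤ k} ≤ (#Y + 1) ^ k := by
  induction k with
  | zero =>
    simp only [Nat.le_zero, Finset.card_eq_zero, pow_zero]
    exact Finset.card_le_one.2 fun a ha b hb => by simp_all
  | succ k ih =>
    set P := {s ∈ Y.powerset | #s ≤ k} with hP
    have hsub : {s ∈ Y.powerset | #s ≤ k + 1} ⊆ P ∪ image₂ insert Y P := by
      intro s hs
      simp only [Finset.mem_filter, Finset.mem_powerset] at hs
      rcases s.eq_empty_or_nonempty with rfl | ⟨a, ha⟩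
      · simp [hP]
      · refine Finset.mem_union_right _ (Finset.mem_image₂.2
          ⟨a, hs.1 ha, s.erase a, ?_, Finset.insert_erase ha⟩)
        simp only [hP, Finset.mem_filter, Finset.mem_powerset, Finset.card_erase_of_mem ha]
        exact ⟨(Finset.erase_subset _ _).trans hs.1, by omega⟩
    calc #{s ∈ Y.powerset | #s ≤ k + 1} ≤ #P + #Y * #P :=
          (Finset.card_le_card hsub).trans ((Finset.card_union_le _ _).trans
            (Nat.add_le_add_left (Finset.card_image₂_le _ _ _) _))
      _ = #P * (#Y + 1) := by ring
      _ ≤ (#Y + 1) ^ k * (#Y + 1) := Nat.mul_le_mul_right _ ih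
      _ = _ := (pow_succ _ _).symm

/-- Used with T a single vertex, for degrees inside a set, and with T a small side of a min-cut. -/
theorem card_between_le (E : Finset (Finset α)) (T X : Finset α) (r : ℕ)
    (h : ∀ e ∈ E, T ⊆ e ∧ e ⊆ X ∧ #e ≤ r) :
    #E ≤ (#(X \ T) + 1) ^ (r - #T) := by
  refine le_trans (Finset.card_le_card_of_injOn (· \ T) ?_ ?_)
    (card_powerset_filter_card_le (X \ T) (r - #T))
  · intro e he
    obtain ⟨h1, h2, h3⟩ := h e he
    simp only [Finset.coe_filter, Finset.mem_powerset, Set.mem_ofPred_eq,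
      Finset.card_sdiff_of_subset h1]
    exact ⟨Finset.sdiff_subset_sdiff h2 le_rfl, by omega⟩
  · intro e he f hf hef
    simp only at hef
    rw [← Finset.sdiff_union_of_subset (h e he).1, hef, Finset.sdiff_union_of_subset (h f hf).1]

theorem sum_card_filter_mem (E : Finset (Finset α)) (S : Finset α) :
    ∑ v ∈ S, #{e ∈ E | v ∈ e} = ∑ e ∈ E, #(e ∩ S) := by
  refine (Finset.sum_card_bipartiteAbove_eq_sum_card_bipartiteBelow fun v e => v ∈ e).trans ?_
  refine Finset.sum_congr rfl fun e _ => ?_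
  congr 1
  ext v
  simp [Finset.bipartiteBelow, and_comm]

theorem card_mul_le_sum_card_inter {X : Finset α} {E : Finset (Finset α)} {k : ℕ}
    (hX : 2 ≤ #X)
    (hk : ∀ C ⊆ X, C.Nonempty → C ≠ X → k ≤ #(boundary E C)) {S : Finset α} (hS : S ⊆ X) :
    #S * k ≤ ∑ e ∈ E, #(e ∩ S) := by
  rw [← sum_card_filter_mem, ← smul_eq_mul]
  refine Finset.card_nsmul_le_sum _ _ _ fun v hv => ?_
  refine (hk {v} (by simpa using hS hv) (by simp) ?_).trans (Finset.card_le_card ?_)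
  · rintro rfl
    simp at hX
  · intro e he
    obtain ⟨h1, ⟨x, hx⟩, -⟩ := mem_boundary.1 he
    simp only [Finset.mem_inter, Finset.mem_singleton] at hx
    exact Finset.mem_filter.2 ⟨h1, hx.2 ▸ hx.1⟩

/-- A vertex of S lies in at most |S|^(r-1) hyperedges inside S; a crossing hyperedge has a vertex
outside S, so it contributes at most r-1. -/
theorem sum_card_inter_le {E : Finset (Finset α)} {r : ℕ} (hr : ∀ e ∈ E, #e ≤ r)
    (S : Finset α) :
    ∑ e ∈ E, #(e ∩ S) ≤ #S * #S ^ (r - 1) + (r - 1) * #(boundary E S) := by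
  have h1 : ∑ e ∈ E with e ⊆ S, #(e ∩ S) ≤ #S * #S ^ (r - 1) := by
    rw [← sum_card_filter_mem, ← smul_eq_mul]
    refine Finset.sum_le_card_nsmul _ _ _ fun v hv => ?_
    refine (card_between_le _ {v} S r fun e he => ?_).trans (le_of_eq ?_)
    · simp only [Finset.mem_filter] at he
      exact ⟨by simpa using he.2, he.1.2, hr e he.1.1⟩
    · rw [Finset.sdiff_singleton_eq_erase, Finset.card_erase_of_mem hv, Finset.card_singleton,
        Nat.sub_add_cancel (Finset.card_pos.2 ⟨v, hv⟩)]
  have h2 : ∑ e ∈ E with ¬ e ⊆ S, #(e ∩ S) ≤ (r - 1) * #(boundary E S) := by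
    rw [mul_comm, ← smul_eq_mul, ← Finset.sum_const, boundary, Finset.sum_filter,
      Finset.sum_filter]
    refine Finset.sum_le_sum fun e he => ?_
    by_cases h3 : e ⊆ S
    · simp [h3]
    have h5 := Finset.sdiff_nonempty.2 h3
    simp only [h3, h5, not_false_eq_true, if_true, and_true]
    split_ifs with h4
    · have : #(e ∩ S) < #e := Finset.card_lt_card
        (Finset.inter_subset_left.ssubset_of_ne fun h => h3 (Finset.inter_eq_left.1 h))
      have := hr e he
      omega
    · simp [Finset.not_nonempty_iff_eq_empty.1 h4]
  rw [← Finset.sum_filter_add_sum_filter_not E (· ⊆ S)]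
  exact Nat.add_le_add h1 h2

/-- A minimum cut with fewer than `r` vertices forces the connectivity to be small. -/
theorem le_two_mul_pow_of_card_lt {X : Finset α} {E : Finset (Finset α)} {k r : ℕ}
    (hE : ∀ e ∈ E, e ⊆ X) (hr : ∀ e ∈ E, #e ≤ r) (hX : 2 ≤ #X)
    (hk : ∀ C ⊆ X, C.Nonempty → C ≠ X → k ≤ #(boundary E C))
    (hbig : 2 * (r * 2 ^ r) ≤ k) {C : Finset α} (hCX : C ⊆ X) (hC : C.Nonempty)
    (hCk : #(boundary E C) = k) (hCr : #C < r) :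
    k ≤ 2 * #X ^ (r - #C) := by
  have h0 := card_mul_le_sum_card_inter hX hk hCX
  set B := {e ∈ boundary E C | C ⊆ e} with hB
  set N := {e ∈ boundary E C | ¬ C ⊆ e} with hN
  have hBN : #B + #N = k := by
    rw [← hCk]; exact Finset.card_filter_add_card_filter_not _
  have hin : #{e ∈ E | e ⊆ C} ≤ 2 ^ r := by
    calc #{e ∈ E | e ⊆ C} ≤ #C.powerset :=
          Finset.card_le_card fun e he => Finset.mem_powerset.2 (Finset.mem_filter.1 he).2
      _ = 2 ^ #C := Finset.card_powerset _
      _ ≤ 2 ^ r := Nat.pow_le_pow_right (by norm_num) hCr.le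
  -- A crossing hyperedge that misses a vertex of C falls at least one short of |C|. Against `h0`
  -- the terms |C|k cancel, leaving a bound on `N` free of k.
  have hsum : ∑ e ∈ E, #(e ∩ C) + #N ≤ #C * #{e ∈ E | e ⊆ C} + #C * k := by
    have hN' : #N = ∑ e ∈ E, if e ∈ N then 1 else 0 := by
      rw [← Finset.sum_filter, Finset.sum_const, smul_eq_mul, mul_one]
      congr 1
      ext e
      simp only [hN, Finset.mem_filter, mem_boundary]
      tauto
    have hb : #C * k = ∑ e ∈ E, if (e ∩ C).Nonempty ∧ (e \ C).Nonempty then #C else 0 := by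
      rw [← Finset.sum_filter, Finset.sum_const, smul_eq_mul, ← hCk, mul_comm]; rfl
    have ha : #C * #{e ∈ E | e ⊆ C} = ∑ e ∈ E, if e ⊆ C then #C else 0 := by
      rw [← Finset.sum_filter, Finset.sum_const, smul_eq_mul, mul_comm]
    rw [hN', ha, hb, ← Finset.sum_add_distrib, ← Finset.sum_add_distrib]
    refine Finset.sum_le_sum fun e he => ?_
    have hle : #(e ∩ C) ≤ #C := Finset.card_le_card Finset.inter_subset_right
    by_cases heN : e ∈ N
    · have h1 := Finset.mem_filter.1 heN
      have h2 := (mem_boundary.1 h1.1).2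
      have : #(e ∩ C) < #C := Finset.card_lt_card
        (Finset.inter_subset_right.ssubset_of_ne fun h => h1.2 (Finset.inter_eq_right.1 h))
      simp only [heN, h2, and_self, if_true]
      omega
    · simp only [heN, if_false, add_zero]
      by_cases h1 : e ⊆ C
      · simp only [h1, if_true]; omega
      · have h2 := Finset.sdiff_nonempty.2 h1
        simp only [h1, h2, and_true, if_false]
        split_ifs with h3
        · omega
        · simp [Finset.not_nonempty_iff_eq_empty.1 h3]
  have hNle : #N ≤ r * 2 ^ r := by
    have : #C * #{e ∈ E | e ⊆ C} ≤ r * 2 ^ r := Nat.mul_le_mul hCr.le hin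
    omega
  have hBle : #B ≤ #X ^ (r - #C) := by
    refine (card_between_le B C X r fun e he => ?_).trans (Nat.pow_le_pow_left ?_ _)
    · simp only [hB, Finset.mem_filter, mem_boundary] at he
      exact ⟨he.2, hE e he.1.1, hr e he.1.1⟩
    · have := Finset.card_sdiff_add_card_eq_card hCX
      have := Finset.card_pos.2 hC
      omega
  omega

/-! ### Uncrossing and laminar families. -/

/-- Two finite sets overlap if they meet and neither contains the other. -/
def Overlap (A B : Finset α) : Prop :=
  (A ∩ B).Nonempty ∧ (A \ B).Nonempty ∧ (B \ A).Nonempty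

theorem overlap_of_overlap_inter {A B D : Finset α} (h : Overlap D (A ∩ B))
    (hDA : ¬ Overlap D A) : Overlap D B := by
  simp only [Overlap, Finset.Nonempty, Finset.mem_inter, Finset.mem_sdiff] at *
  grind

theorem overlap_of_overlap_sdiff {A B D : Finset α} (hAB : Overlap A B)
    (h : Overlap D (B \ A)) (hDA : ¬ Overlap D A) : Overlap D B := by
  simp only [Overlap, Finset.Nonempty, Finset.mem_inter, Finset.mem_sdiff] at *
  grind

/-- In a family closed under uncrossing, a maximal laminar subfamily separates every pair that the
whole family separates. -/
theorem exists_laminar_separating (M : Finset (Finset α))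
    (hM : ∀ A ∈ M, ∀ B ∈ M, Overlap A B → A ∩ B ∈ M ∧ B \ A ∈ M) :
    ∃ F ⊆ M, (∀ A ∈ F, ∀ B ∈ F, ¬ Overlap A B) ∧
      ∀ B ∈ M, ∀ u ∈ B, ∀ v ∉ B, ∃ A ∈ F, ¬ (u ∈ A ↔ v ∈ A) := by
  classical
  obtain ⟨F, hF, hmax⟩ := Finset.exists_max_image
    {F ∈ M.powerset | ∀ A ∈ F, ∀ B ∈ F, ¬ Overlap A B} Finset.card ⟨∅, by simp⟩
  simp only [Finset.mem_filter, Finset.mem_powerset] at hF hmax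
  refine ⟨F, hF.1, hF.2, fun B hB u hu v hv => ?_⟩
  by_contra! hsep
  -- Descent on the number of members of F overlapping B. An overlapping A has u and v on the same
  -- side, so `A ∩ B` or `B \ A` still separates them; it loses the overlap with A and gains none.
  -- With no overlap left, B could be added to F, against maximality.
  obtain ⟨n, hn⟩ : ∃ n, n = #{A ∈ F | Overlap A B} := ⟨_, rfl⟩
  induction n using Nat.strong_induction_on generalizing B with
  | _ n ih =>
    have step : ∀ A ∈ F, Overlap A B → ∀ B' ∈ M, u ∈ B' → v ∉ B' → ¬ Overlap A B' →
        (∀ D ∈ F, Overlap D B' → Overlap D B) → False := by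
      intro A hA hAB B' hB' hu' hv' hnot himp
      refine ih _ ?_ B' hB' hu' hv' rfl
      rw [hn]
      refine Finset.card_lt_card (Finset.ssubset_iff_of_subset ?_ |>.2 ⟨A, ?_, ?_⟩)
      · intro D hD
        simp only [Finset.mem_filter] at hD ⊢
        exact ⟨hD.1, himp D hD.1 hD.2⟩
      · simp [hA, hAB]
      · simp [hnot]
    by_cases hcross : ∃ A ∈ F, Overlap A B
    · obtain ⟨A, hA, hAB⟩ := hcross
      obtain ⟨h1, h2⟩ := hM A (hF.1 hA) B hB hAB
      by_cases huA : u ∈ A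
      · have hvA : v ∈ A := (hsep A hA).1 huA
        refine step A hA hAB (A ∩ B) h1 (by simp [*]) (by simp [*]) ?_ ?_
        · rintro ⟨-, -, x, hx⟩
          simp only [Finset.mem_sdiff, Finset.mem_inter] at hx
          exact hx.2 hx.1.1
        · intro D hD hDB
          exact overlap_of_overlap_inter hDB (hF.2 D hD A hA)
      · refine step A hA hAB (B \ A) h2 (by simp [hu, huA]) (by simp [hv]) ?_ ?_
        · rintro ⟨⟨x, hx⟩, -, -⟩
          simp at hx
        · intro D hD hDB
          exact overlap_of_overlap_sdiff hAB hDB (hF.2 D hD A hA)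
    · push Not at hcross
      have hBF : B ∉ F := fun h => hv ((hsep B h).1 hu)
      have := hmax (insert B F) ⟨Finset.insert_subset hB hF.1, ?_⟩
      · rw [Finset.card_insert_of_notMem hBF] at this
        omega
      · have hself : ¬ Overlap B B := by simp [Overlap]
        have hcomm : ∀ A ∈ F, ¬ Overlap B A := fun A hA h =>
          hcross A hA ⟨by rw [Finset.inter_comm]; exact h.1, h.2.2, h.2.1⟩
        simp only [Finset.mem_insert]
        rintro A (rfl | hA) D (rfl | hD)
        exacts [hself, hcomm D hD, hcross A hA, hF.2 A hA D hD]

theorem subset_or_superset_or_disjoint {A B : Finset α} (h : ¬ Overlap A B) :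
    A ⊆ B ∨ B ⊆ A ∨ Disjoint A B := by
  simp only [Overlap, Finset.Nonempty, Finset.mem_inter, Finset.mem_sdiff, Finset.subset_iff,
    Finset.disjoint_left] at *
  grind

/-- In a laminar family, the members inside `S` that are not larger than a maximal one `D` lie in
`D` or avoid it. -/
theorem card_filter_subset_le {F G : Finset (Finset α)} {S D : Finset α}
    (hF : ∀ A ∈ F, ∀ B ∈ F, ¬ Overlap A B) (hGF : G ⊆ F) (hGS : ∀ A ∈ G, A ⊆ S) (hD : D ∈ G)
    (hmax : ∀ A ∈ G, #A ≤ #D) :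
    #G ≤ #{A ∈ F | A ⊆ D} + #{A ∈ F | A ⊆ S \ D} := by
  refine le_trans (Finset.card_le_card fun A hA => ?_) (Finset.card_union_le _ _)
  simp only [Finset.mem_union, Finset.mem_filter]
  rcases subset_or_superset_or_disjoint (hF A (hGF hA) D (hGF hD)) with h | h | h
  · exact Or.inl ⟨hGF hA, h⟩
  · exact Or.inl ⟨hGF hA, (Finset.eq_of_subset_of_card_le h (hmax A hA)).ge⟩
  · exact Or.inr ⟨hGF hA, Finset.subset_sdiff.2 ⟨hGS A hA, h⟩⟩

/-- A laminar family of large sets whose nested differences are either tiny or large has few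
members. -/
theorem laminar_card_mul_le {F : Finset (Finset α)} {q : ℕ} {L : ℝ}
    (hF : ∀ A ∈ F, ∀ B ∈ F, ¬ Overlap A B) (hqL : (q : ℝ) < L) (hL : ∀ A ∈ F, L ≤ #A)
    (hd : ∀ A ∈ F, ∀ B ∈ F, B ⊆ A → #(A \ B) ≤ q ∨ L ≤ #(A \ B)) (S : Finset α) :
    #{A ∈ F | A ⊆ S} = 0 ∨ ((#{A ∈ F | A ⊆ S} : ℝ) + (q + 1)) * L ≤ (2 * q + 2) * #S := by
  -- The extra q+1 makes the induction close: joining the bounds for D and S \ D leaves one q+1 to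
  -- spare, which pays for the members within q of S. An empty family has to be excepted, since S
  -- may then be small.
  have hL0 : 0 < L := lt_of_le_of_lt (Nat.cast_nonneg q) hqL
  have hq0 : (0 : ℝ) ≤ q := Nat.cast_nonneg q
  induction hs : #S using Nat.strong_induction_on generalizing S with
  | _ n ih =>
  subst hs
  refine or_iff_not_imp_left.2 fun hne => ?_
  have hpos : ∀ A ∈ F, 0 < #A := fun A hA => by exact_mod_cast hL0.trans_le (hL A hA)
  have key : ∀ D ∈ F, D ⊆ S → D ≠ S →
      ((#{A ∈ F | A ⊆ D} : ℝ) + (q + 1)) * L ≤ (2 * q + 2) * #D ∧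
      (#{A ∈ F | A ⊆ S \ D} = 0 ∨
        ((#{A ∈ F | A ⊆ S \ D} : ℝ) + (q + 1)) * L ≤ (2 * q + 2) * #(S \ D)) ∧
      (#(S \ D) : ℝ) + #D = #S := by
    intro D hD hDS hne
    have hc := Finset.card_sdiff_add_card_eq_card hDS
    have hlt := Finset.card_lt_card (hDS.ssubset_of_ne hne)
    have := hpos D hD
    refine ⟨(ih _ hlt D rfl).resolve_left ?_, ih _ (by omega) _ rfl, by exact_mod_cast hc⟩
    exact Finset.card_ne_zero_of_mem (Finset.mem_filter.2 ⟨hD, subset_rfl⟩)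
  by_cases hSF : S ∈ F
  · set G₁ := {A ∈ {A ∈ F | A ⊆ S} | #(S \ A) ≤ q} with hG₁
    set G₂ := {A ∈ {A ∈ F | A ⊆ S} | ¬ #(S \ A) ≤ q} with hG₂
    have hsplit : #G₁ + #G₂ = #{A ∈ F | A ⊆ S} := Finset.card_filter_add_card_filter_not _
    -- Members within q of S form a chain, since disjoint ones would have at most q < L elements;
    -- their codimensions in S are distinct values in 0, ..., q.
    have h₁ : #G₁ ≤ q + 1 := by
      rw [← Finset.card_range (q + 1)]
      refine Finset.card_le_card_of_injOn (fun A => #(S \ A)) ?_ ?_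
      · intro A hA
        have := (Finset.mem_filter.1 (Finset.mem_coe.1 hA)).2
        simp only [Finset.coe_range, Set.mem_Iio]
        omega
      · intro A hA B hB hAB
        simp only [hG₁, Finset.coe_filter, Finset.mem_filter, Set.mem_ofPred_eq] at hA hB
        simp only at hAB
        have hcA := Finset.card_sdiff_add_card_eq_card hA.1.2
        have hcB := Finset.card_sdiff_add_card_eq_card hB.1.2
        rcases subset_or_superset_or_disjoint (hF A hA.1.1 B hB.1.1) with h | h | h
        · exact Finset.eq_of_subset_of_card_le h (by omega)
        · exact (Finset.eq_of_subset_of_card_le h (by omega)).symm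
        · have h1 : #A ≤ #(S \ B) := Finset.card_le_card (Finset.subset_sdiff.2 ⟨hA.1.2, h⟩)
          have h2 : (#A : ℝ) ≤ q := by exact_mod_cast h1.trans hB.2
          linarith [hL A hA.1.1]
    have h₁' : (#G₁ : ℝ) ≤ q + 1 := by exact_mod_cast h₁
    rw [← hsplit]
    push_cast
    rcases G₂.eq_empty_or_nonempty with h0 | hne₂
    · rw [h0]
      have := hL S hSF
      simp only [Finset.card_empty, Nat.cast_zero, add_zero]
      nlinarith
    · obtain ⟨D, hD, hmax⟩ := Finset.exists_max_image G₂ Finset.card hne₂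
      have hD' := hD
      simp only [hG₂, Finset.mem_filter] at hD'
      obtain ⟨k1, k2, k3⟩ := key D hD'.1.1 hD'.1.2 (by rintro rfl; simp at hD')
      have hgap := (hd S hSF D hD'.1.1 hD'.1.2).resolve_left hD'.2
      have hc : (#G₂ : ℝ) ≤ #{A ∈ F | A ⊆ D} + #{A ∈ F | A ⊆ S \ D} := by
        exact_mod_cast card_filter_subset_le hF
          ((Finset.filter_subset _ _).trans (Finset.filter_subset _ _))
          (fun A hA => (Finset.mem_filter.1 (Finset.mem_filter.1 hA).1).2) hD hmax
      rw [← k3]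
      have e1 := mul_le_mul_of_nonneg_right (add_le_add h₁' hc) hL0.le
      rcases k2 with k2 | k2
      · rw [k2] at e1
        push_cast at e1
        nlinarith
      · nlinarith
  · obtain ⟨D, hD, hmax⟩ := Finset.exists_max_image {A ∈ F | A ⊆ S} Finset.card
      (Finset.card_pos.1 (Nat.pos_of_ne_zero hne))
    have hD' := Finset.mem_filter.1 hD
    obtain ⟨k1, k2, k3⟩ := key D hD'.1 hD'.2 (by rintro rfl; exact hSF hD'.1)
    have hc : (#{A ∈ F | A ⊆ S} : ℝ) ≤ #{A ∈ F | A ⊆ D} + #{A ∈ F | A ⊆ S \ D} := by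
      exact_mod_cast card_filter_subset_le hF (Finset.filter_subset _ _)
        (fun A hA => (Finset.mem_filter.1 hA).2) hD hmax
    rw [← k3]
    have e1 := mul_le_mul_of_nonneg_right hc hL0.le
    have e2 : (0 : ℝ) ≤ (2 * q + 2) * #(S \ D) := by positivity
    rcases k2 with k2 | k2
    · rw [k2] at e1
      push_cast at e1
      nlinarith
    · nlinarith

/-! ### Submodularity and the sizes of min-cuts. -/

theorem boundary_sdiff {E : Finset (Finset α)} {X : Finset α} (hE : ∀ e ∈ E, e ⊆ X)
    (C : Finset α) : boundary E (X \ C) = boundary E C := by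
  ext e
  simp only [mem_boundary]
  refine and_congr_right fun he => ?_
  have := hE e he
  simp only [Finset.Nonempty, Finset.mem_inter, Finset.mem_sdiff, Finset.subset_iff] at *
  grind

theorem card_boundary_inter_add_union_le (E : Finset (Finset α)) (A B : Finset α) :
    #(boundary E (A ∩ B)) + #(boundary E (A ∪ B)) ≤ #(boundary E A) + #(boundary E B) := by
  rw [← Finset.card_union_add_card_inter, ← Finset.card_union_add_card_inter (boundary E A)]
  refine Nat.add_le_add (Finset.card_le_card fun e he => ?_) (Finset.card_le_card fun e he => ?_)
  all_goals
    simp only [Finset.mem_union, Finset.mem_inter, mem_boundary, Finset.Nonempty,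
      Finset.mem_sdiff] at *
    grind

/-- Posimodularity: a hyperedge crossing both differences meets both, hence crosses A and B. Besides
uncrossing, it bounds the boundary of a difference of two min-cuts by 2k. -/
theorem card_boundary_sdiff_add_sdiff_le (E : Finset (Finset α)) (A B : Finset α) :
    #(boundary E (A \ B)) + #(boundary E (B \ A)) ≤ #(boundary E A) + #(boundary E B) := by
  rw [← Finset.card_union_add_card_inter, ← Finset.card_union_add_card_inter (boundary E A)]
  refine Nat.add_le_add (Finset.card_le_card fun e he => ?_) (Finset.card_le_card fun e he => ?_)
  all_goals
    simp only [Finset.mem_union, Finset.mem_inter, mem_boundary, Finset.Nonempty,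
      Finset.mem_sdiff] at *
    grind

/-- Crossing hyperedges account for at most 2rk < |S|k/2 of the degree sum, so those inside S supply
at least half, while they supply at most |S|^r. -/
theorem le_two_mul_card_pow {X : Finset α} {E : Finset (Finset α)} {k r : ℕ}
    (hr : ∀ e ∈ E, #e ≤ r) (hX : 2 ≤ #X)
    (hk : ∀ C ⊆ X, C.Nonempty → C ≠ X → k ≤ #(boundary E C)) {S : Finset α} (hS : S ⊆ X)
    (hSk : #(boundary E S) ≤ 2 * k) (hSr : 4 * r < #S) : k ≤ 2 * #S ^ (r - 1) := by
  have h1 := (card_mul_le_sum_card_inter hX hk hS).trans (sum_card_inter_le hr S)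
  have h2 : (r - 1) * #(boundary E S) ≤ r * (2 * k) := Nat.mul_le_mul (Nat.sub_le _ _) hSk
  have h3 : 4 * r * k ≤ #S * k := Nat.mul_le_mul_right _ hSr.le
  refine le_of_mul_le_mul_left (a := #S) ?_ (by omega)
  nlinarith

theorem four_mul_pow_lt {k r : ℕ} (hr : 2 ≤ r) (hbig : r * (4 * r ^ 2) ^ r ≤ k) :
    (4 * r) ^ r < k := by
  have h1 : (4 * r) ^ r ≤ (4 * r ^ 2) ^ r := Nat.pow_le_pow_left (by nlinarith) _
  have h2 : 0 < (4 * r) ^ r := by positivity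
  nlinarith

/-- If r ≤ |S| ≤ 4r, the degree count rk ≤ (4r)^r + (r-1)k gives k ≤ (4r)^r, too small. -/
theorem four_mul_lt_card {X : Finset α} {E : Finset (Finset α)} {k r : ℕ}
    (hr : ∀ e ∈ E, #e ≤ r) (hX : 2 ≤ #X) (hr2 : 2 ≤ r) (hbig : r * (4 * r ^ 2) ^ r ≤ k)
    (hk : ∀ C ⊆ X, C.Nonempty → C ≠ X → k ≤ #(boundary E C)) {S : Finset α} (hS : S ⊆ X)
    (hSk : #(boundary E S) = k) (hSr : r ≤ #S) : 4 * r < #S := by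
  by_contra! hlt
  have h1 := (card_mul_le_sum_card_inter hX hk hS).trans (sum_card_inter_le hr S)
  have h2 : #S * #S ^ (r - 1) ≤ (4 * r) ^ r := by
    rw [← pow_succ', Nat.sub_add_cancel (by omega)]
    exact Nat.pow_le_pow_left hlt _
  have h3 : r * k ≤ #S * k := Nat.mul_le_mul_right _ hSr
  have h4 := four_mul_pow_lt hr2 hbig
  obtain ⟨s, rfl⟩ : ∃ s, r = s + 1 := ⟨r - 1, by omega⟩
  rw [hSk] at h1
  simp only [Nat.add_sub_cancel] at h1 h2
  nlinarith

/-- If every minimum cut has at least `r` vertices on each side, then few edges cross minimum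
cuts. -/
theorem card_minCut_union_mul_le {X : Finset α} {E : Finset (Finset α)} {k r : ℕ} {L : ℝ}
    (hE : ∀ e ∈ E, e ⊆ X) (hr : ∀ e ∈ E, #e ≤ r) (hX : 2 ≤ #X) (hr2 : 2 ≤ r)
    (hbig : r * (4 * r ^ 2) ^ r ≤ k)
    (hk : ∀ C ⊆ X, C.Nonempty → C ≠ X → k ≤ #(boundary E C))
    (hlarge : ∀ C ⊆ X, C.Nonempty → C ≠ X → #(boundary E C) = k → r ≤ #C)
    (hL0 : 0 ≤ L) (hL : L ^ (r - 1) = k / 2) {U : Finset (Finset α)}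
    (hU : ∀ e ∈ U, ∃ C ⊆ X, C.Nonempty ∧ C ≠ X ∧ #(boundary E C) = k ∧ e ∈ boundary E C) :
    (#U : ℝ) * L ≤ (8 * r + 2) * #X * k := by
  obtain ⟨ρ, hρ⟩ : X.Nonempty := Finset.card_pos.1 (by omega)
  have hneX : ∀ {A : Finset α}, ρ ∉ A → A ≠ X := fun h h' => h (h' ▸ hρ)
  -- Avoiding ρ keeps unions of members proper, so submodularity applies to every overlapping pair.
  set M := {C ∈ X.powerset | C.Nonempty ∧ ρ ∉ C ∧ #(boundary E C) = k} with hM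
  have memM : ∀ {C}, C ∈ M ↔ C ⊆ X ∧ C.Nonempty ∧ ρ ∉ C ∧ #(boundary E C) = k := by
    simp [hM]
  have hrpos : r - 1 ≠ 0 := by omega
  have hbase : ∀ s : ℕ, k ≤ 2 * s ^ (r - 1) → L ≤ s := by
    intro s hs
    refine (pow_le_pow_iff_left₀ hL0 (Nat.cast_nonneg s) hrpos).1 ?_
    have : (k : ℝ) ≤ 2 * (s : ℝ) ^ (r - 1) := by exact_mod_cast hs
    rw [hL]
    linarith
  have hqL : ((4 * r : ℕ) : ℝ) < L := by
    refine (pow_lt_pow_iff_left₀ (Nat.cast_nonneg _) hL0 hrpos).1 ?_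
    have h1 := four_mul_pow_lt hr2 hbig
    obtain ⟨s, rfl⟩ : ∃ s, r = s + 1 := ⟨r - 1, by omega⟩
    rw [pow_succ] at h1
    have h2 : 2 * (4 * (s + 1)) ^ s < k := by
      have : 0 < (4 * (s + 1)) ^ s := by positivity
      nlinarith
    have h3 : 2 * (((4 * (s + 1) : ℕ) : ℝ)) ^ s < k := by exact_mod_cast h2
    rw [hL]
    simp only [Nat.add_sub_cancel]
    linarith
  have hMcross : ∀ A ∈ M, ∀ B ∈ M, Overlap A B → A ∩ B ∈ M ∧ B \ A ∈ M := by
    intro A hA B hB hAB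
    rw [memM] at hA hB
    have hAB' := hAB.2.2
    have u1 := hk (A ∩ B) (Finset.inter_subset_left.trans hA.1) hAB.1
      (hneX fun h => hA.2.2.1 (Finset.mem_inter.1 h).1)
    have u2 := hk (A ∪ B) (Finset.union_subset hA.1 hB.1) (hA.2.1.mono Finset.subset_union_left)
      (hneX fun h => (Finset.mem_union.1 h).elim hA.2.2.1 hB.2.2.1)
    have u3 := hk (A \ B) (Finset.sdiff_subset.trans hA.1) hAB.2.1
      (hneX fun h => hA.2.2.1 (Finset.mem_sdiff.1 h).1)
    have u4 := hk (B \ A) (Finset.sdiff_subset.trans hB.1) hAB.2.2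
      (hneX fun h => hB.2.2.1 (Finset.mem_sdiff.1 h).1)
    have v1 := card_boundary_inter_add_union_le E A B
    have v2 := card_boundary_sdiff_add_sdiff_le E A B
    rw [hA.2.2.2, hB.2.2.2] at v1 v2
    rw [memM, memM]
    exact ⟨⟨Finset.inter_subset_left.trans hA.1, hAB.1,
        fun h => hA.2.2.1 (Finset.mem_inter.1 h).1, by omega⟩,
      ⟨Finset.sdiff_subset.trans hB.1, hAB.2.2,
        fun h => hB.2.2.1 (Finset.mem_sdiff.1 h).1, by omega⟩⟩
  obtain ⟨F, hFM, hFlam, hFsep⟩ := exists_laminar_separating M hMcross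
  have hF : ∀ {C}, C ∈ F → C ⊆ X ∧ C.Nonempty ∧ ρ ∉ C ∧ #(boundary E C) = k :=
    fun h => memM.1 (hFM h)
  have hcount : (#F : ℝ) * L ≤ (8 * r + 2) * #X := by
    have h1 := laminar_card_mul_le (q := 4 * r) (L := L) hFlam hqL ?_ ?_ X
    · rw [Finset.filter_true_of_mem fun A hA => (hF hA).1] at h1
      rcases h1 with h1 | h1
      · rw [h1]
        simp only [Nat.cast_zero, zero_mul]
        positivity
      · push_cast at h1
        have : 0 ≤ (4 * (r : ℝ) + 1) * L := by positivity
        linarith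
    · intro A hA
      obtain ⟨a1, a2, a3, a4⟩ := hF hA
      exact hbase _ (le_two_mul_card_pow hr hX hk a1 (by omega)
        (four_mul_lt_card hr hX hr2 hbig hk a1 a4 (hlarge A a1 a2 (hneX a3) a4)))
    · intro A hA B hB _
      rcases le_or_gt #(A \ B) (4 * r) with h | h
      · exact Or.inl h
      · refine Or.inr (hbase _ (le_two_mul_card_pow hr hX hk
          (Finset.sdiff_subset.trans (hF hA).1) ?_ h))
        have := card_boundary_sdiff_add_sdiff_le E A B
        have := (hF hA).2.2.2
        have := (hF hB).2.2.2
        omega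
  have hUF : #U ≤ #F * k := by
    have hsub : U ⊆ F.biUnion (boundary E) := by
      intro e he
      obtain ⟨C, hCX, hC, hCne, hCk, heC⟩ := hU e he
      obtain ⟨D, hD, heD⟩ : ∃ D ∈ M, e ∈ boundary E D := by
        by_cases h : ρ ∈ C
        · refine ⟨X \ C, memM.2 ⟨Finset.sdiff_subset, ?_, by simp [h], ?_⟩, ?_⟩
          · exact Finset.sdiff_nonempty.2 fun h' => hCne (hCX.antisymm h')
          · rwa [boundary_sdiff hE C]
          · rwa [boundary_sdiff hE C]
        · exact ⟨C, memM.2 ⟨hCX, hC, h, hCk⟩, heC⟩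
      obtain ⟨heE, ⟨u, hu⟩, ⟨v, hv⟩⟩ := mem_boundary.1 heD
      rw [Finset.mem_inter] at hu
      rw [Finset.mem_sdiff] at hv
      -- The hyperedge contains u and v, so any member of F separating them is crossed by it.
      obtain ⟨A, hA, hAuv⟩ := hFsep D hD u hu.2 v hv.2
      refine Finset.mem_biUnion.2 ⟨A, hA, mem_boundary.2 ⟨heE, ?_⟩⟩
      by_cases huA : u ∈ A
      · exact ⟨⟨u, Finset.mem_inter.2 ⟨hu.1, huA⟩⟩, v, Finset.mem_sdiff.2 ⟨hv.1, by tauto⟩⟩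
      · exact ⟨⟨v, Finset.mem_inter.2 ⟨hv.1, by tauto⟩⟩, u, Finset.mem_sdiff.2 ⟨hu.1, huA⟩⟩
    exact (Finset.card_le_card hsub).trans
      (Finset.card_biUnion_le_card_mul _ _ _ fun A hA => (hF hA).2.2.2.le)
  have hUF' : (#U : ℝ) ≤ #F * k := by exact_mod_cast hUF
  calc (#U : ℝ) * L ≤ #F * k * L := mul_le_mul_of_nonneg_right hUF' hL0
    _ = #F * L * k := by ring
    _ ≤ (8 * r + 2) * #X * k := mul_le_mul_of_nonneg_right hcount (Nat.cast_nonneg k)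

theorem card_mul_le_rank_mul_card {X : Finset α} {E : Finset (Finset α)} {k r : ℕ}
    (hr : ∀ e ∈ E, #e ≤ r) (hX : 2 ≤ #X)
    (hk : ∀ C ⊆ X, C.Nonempty → C ≠ X → k ≤ #(boundary E C)) : #X * k ≤ r * #E := by
  refine (card_mul_le_sum_card_inter hX hk subset_rfl).trans ?_
  rw [mul_comm, ← smul_eq_mul]
  exact Finset.sum_le_card_nsmul _ _ _ fun e he =>
    (Finset.card_le_card Finset.inter_subset_left).trans (hr e he)

end Finite

/-! ### Passage from `Hypergraph` to finite families. -/

section Translation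

/-- The hyperedges of `H` that lie in the finite set `X`, as finite sets. -/
noncomputable def finiteEdges {V : Type*} (H : Hypergraph V) (X : Finset V) :
    Finset (Finset V) :=
  open Classical in {e ∈ X.powerset | (e : Set V) ∈ H.edgeSet}

variable {V : Type*} {H : Hypergraph V} {X : Finset V}

theorem mem_finiteEdges (hX : (X : Set V) = H.vertexSet) {e : Finset V} :
    e ∈ finiteEdges H X ↔ (e : Set V) ∈ H.edgeSet := by
  simp only [finiteEdges, Finset.mem_filter, Finset.mem_powerset, and_iff_right_iff_imp]
  intro he
  have := H.subset_vertexSet_of_mem_edgeSet he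
  rwa [← hX, Finset.coe_subset] at this

theorem exists_coe_eq (hX : (X : Set V) = H.vertexSet) {e : Set V} (he : e ⊆ H.vertexSet) :
    ∃ f : Finset V, (f : Set V) = e ∧ f ⊆ X := by
  have hfin : e.Finite := (X.finite_toSet.subset (hX ▸ he))
  refine ⟨hfin.toFinset, hfin.coe_toFinset, ?_⟩
  rw [← Finset.coe_subset, hfin.coe_toFinset, hX]
  exact he

theorem ncard_eq_card {P : Finset (Finset V)} {Q : Set (Set V)}
    (hX : (X : Set V) = H.vertexSet) (hQ : Q ⊆ H.edgeSet)
    (h : ∀ e : Finset V, e ∈ P ↔ (e : Set V) ∈ Q) : Q.ncard = #P := by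
  have : Q = (fun e : Finset V => (e : Set V)) '' (P : Set (Finset V)) := by
    ext e
    constructor
    · intro he
      obtain ⟨f, rfl, -⟩ := exists_coe_eq hX (H.subset_vertexSet_of_mem_edgeSet (hQ he))
      exact ⟨f, (h f).2 he, rfl⟩
    · rintro ⟨f, hf, rfl⟩
      exact (h f).1 hf
  rw [this, Set.ncard_image_of_injective _ Finset.coe_injective, Set.ncard_coe_finset]

variable [DecidableEq V]

theorem mem_boundary_iff_mem_cutEdges (hX : (X : Set V) = H.vertexSet) (C e : Finset V) :
    e ∈ boundary (finiteEdges H X) C ↔ (e : Set V) ∈ H.cutEdges C := by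
  rw [mem_boundary, mem_finiteEdges hX, Hypergraph.cutEdges, Set.mem_ofPred_eq]
  refine and_congr_right fun he => and_congr ?_ ?_
  · rw [← Finset.coe_inter, Finset.coe_nonempty]
  · rw [← Finset.coe_nonempty, Finset.coe_sdiff]
    have := H.subset_vertexSet_of_mem_edgeSet he
    rw [← Set.inter_sdiff_assoc, Set.inter_eq_left.2 this]

theorem cutCapacity_eq (hX : (X : Set V) = H.vertexSet) (C : Finset V) :
    H.cutCapacity C = #(boundary (finiteEdges H X) C) :=
  ncard_eq_card hX (fun _ h => h.1) (mem_boundary_iff_mem_cutEdges hX C)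

theorem isCut_coe_iff (hX : (X : Set V) = H.vertexSet) (C : Finset V) :
    H.IsCut C ↔ C ⊆ X ∧ C.Nonempty ∧ C ≠ X := by
  rw [Hypergraph.IsCut, ← hX, ← Finset.coe_sdiff, Finset.coe_nonempty, Finset.coe_nonempty,
    Finset.coe_subset, Finset.sdiff_nonempty]
  refine and_congr_right fun h => and_congr_right fun _ => not_congr ?_
  exact ⟨fun h' => h.antisymm h', fun h' => h' ▸ subset_rfl⟩

end Translation

end HypergraphMinCut

/-! ### The dichotomy and the final estimates. -/

open HypergraphMinCut Finset in
/-- Either a small minimum cut exists or the union of the minimum cuts has few hyperedges. -/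
theorem Hypergraph.exists_small_minCut_or_ncard_minCutEdges_le {V : Type*} (G : Hypergraph V)
    {r k : ℕ} (hfin : G.vertexSet.Finite) (hr2 : 2 ≤ r) (hr : G.HasRank r)
    (hconn : G.HasConnectivity k) (hbig : r * (4 * r ^ 2) ^ r ≤ k) :
    2 ≤ G.vertexSet.ncard ∧
    ((∃ C : Set V, G.IsMinCut C ∧ G.cutSize C ≤ r ∧
        k ≤ 2 * G.vertexSet.ncard ^ (r - G.cutSize C)) ∨
      ∀ L : ℝ, 0 ≤ L → L ^ (r - 1) = k / 2 →
        (G.minCutEdges.ncard : ℝ) * L ≤ (8 * r + 2) * (r * G.edgeSet.ncard)) := by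
  classical
  obtain ⟨X, hX⟩ : ∃ X : Finset V, (X : Set V) = G.vertexSet := ⟨hfin.toFinset, hfin.coe_toFinset⟩
  set E := finiteEdges G X with hEdef
  obtain ⟨C₀, ⟨hcut, hmin⟩, hCk⟩ := hconn
  obtain ⟨C₀, rfl, -⟩ := exists_coe_eq hX hcut.1
  have hk : ∀ C ⊆ X, C.Nonempty → C ≠ X → k ≤ #(boundary E C) := fun C h1 h2 h3 => by
    rw [← hCk, ← cutCapacity_eq hX]
    exact hmin _ ((isCut_coe_iff hX C).2 ⟨h1, h2, h3⟩)
  have hminCut : ∀ C : Finset V, G.IsMinCut C ↔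
      C ⊆ X ∧ C.Nonempty ∧ C ≠ X ∧ #(boundary E C) = k := by
    intro C
    rw [Hypergraph.IsMinCut, isCut_coe_iff hX, cutCapacity_eq hX]
    constructor
    · rintro ⟨⟨h1, h2, h3⟩, h4⟩
      exact ⟨h1, h2, h3, (hCk ▸ h4 _ hcut).antisymm (hk C h1 h2 h3)⟩
    · rintro ⟨h1, h2, h3, h4⟩
      exact ⟨⟨h1, h2, h3⟩, fun D hD => h4.le.trans (hCk ▸ hmin D hD)⟩
  have hE : ∀ e ∈ E, e ⊆ X := fun e he => Finset.mem_powerset.1 (Finset.mem_filter.1 he).1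
  have hrE : ∀ e ∈ E, #e ≤ r := fun e he => by
    have := hr.2 ⟨_, (mem_finiteEdges hX).1 he, rfl⟩
    rwa [Set.ncard_coe_finset] at this
  have hn : G.vertexSet.ncard = #X := by rw [← hX, Set.ncard_coe_finset]
  have hX2 : 2 ≤ #X := by
    obtain ⟨h1, h2, h3⟩ := (isCut_coe_iff hX C₀).1 hcut
    have := Finset.card_lt_card (h1.ssubset_of_ne h3)
    have := Finset.card_pos.2 h2
    omega
  have hsize : ∀ C ⊆ X, G.cutSize (C : Set V) = min #C #(X \ C) := fun C _ => by
    rw [Hypergraph.cutSize, ← hX, ← Finset.coe_sdiff, Set.ncard_coe_finset, Set.ncard_coe_finset]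
  rw [hn]
  refine ⟨hX2, ?_⟩
  by_cases hsmall : ∃ C ⊆ X, C.Nonempty ∧ C ≠ X ∧ #(boundary E C) = k ∧ #C < r
  · left
    obtain ⟨C, h1, h2, h3, h4, h5⟩ := hsmall
    have hle : G.cutSize (C : Set V) ≤ #C := (hsize C h1).le.trans (min_le_left _ _)
    refine ⟨C, (hminCut C).2 ⟨h1, h2, h3, h4⟩, hle.trans h5.le, ?_⟩
    -- Replacing |C| by the possibly smaller `cutSize` only raises the exponent.
    refine (le_two_mul_pow_of_card_lt hE hrE hX2 hk ?_ h1 h2 h4 h5).trans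
      (Nat.mul_le_mul_left _ (Nat.pow_le_pow_right (by omega) (by omega)))
    refine le_trans ?_ hbig
    have e1 : (4 : ℕ) ^ r ≤ (4 * r ^ 2) ^ r := Nat.pow_le_pow_left (by nlinarith) _
    have e2 : 2 * 2 ^ r ≤ 4 ^ r := by
      rw [show (4 : ℕ) = 2 * 2 by rfl, mul_pow]
      exact Nat.mul_le_mul_right _ (Nat.le_self_pow (by omega) 2)
    calc 2 * (r * 2 ^ r) = r * (2 * 2 ^ r) := by ring
      _ ≤ _ := Nat.mul_le_mul_left _ (e2.trans e1)
  · right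
    push Not at hsmall
    intro L hL0 hL
    have hUeq : G.minCutEdges.ncard =
        #{e ∈ E | ∃ C ⊆ X, C.Nonempty ∧ C ≠ X ∧ #(boundary E C) = k ∧ e ∈ boundary E C} := by
      refine ncard_eq_card hX (fun e ⟨C, _, h⟩ => h.1) fun e => ?_
      rw [Finset.mem_filter]
      constructor
      · rintro ⟨-, C, h1, h2, h3, h4, h5⟩
        exact ⟨C, (hminCut C).2 ⟨h1, h2, h3, h4⟩, (mem_boundary_iff_mem_cutEdges hX C e).1 h5⟩
      · rintro ⟨C, hC, he⟩
        obtain ⟨C, rfl, -⟩ := exists_coe_eq hX hC.1.1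
        obtain ⟨h1, h2, h3, h4⟩ := (hminCut C).1 hC
        exact ⟨(mem_finiteEdges hX).2 he.1, C, h1, h2, h3, h4,
          (mem_boundary_iff_mem_cutEdges hX C e).2 he⟩
    have hm : G.edgeSet.ncard = #E :=
      ncard_eq_card hX subset_rfl fun e => mem_finiteEdges hX
    rw [hUeq, hm]
    refine (card_minCut_union_mul_le hE hrE hX2 hr2 hbig hk hsmall hL0 hL
      fun e he => (Finset.mem_filter.1 he).2).trans ?_
    have : (#X : ℝ) * k ≤ r * #E := by exact_mod_cast card_mul_le_rank_mul_card hrE hX2 hk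
    rw [mul_assoc]
    exact mul_le_mul_of_nonneg_left this (by positivity)

theorem Hypergraph.half_le_log_natCast {n : ℕ} (hn : 2 ≤ n) : 1 / 2 ≤ Real.log n := by
  have h1 : Real.log 2 ≤ Real.log n := Real.log_le_log (by norm_num) (by exact_mod_cast hn)
  linarith [Real.log_two_gt_d9]

theorem theorem2 :
    ∃ (K : ℝ) (h : ℕ → ℝ) (k : ℕ), 0 < K ∧
      ∀ (V : Type*) (G : Hypergraph V) (r n m lam : ℕ),
        G.vertexSet.Finite →
        G.vertexSet.ncard = n →
        G.edgeSet.ncard = m →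
        2 ≤ r →
        G.HasRank r →
        G.HasConnectivity lam →
        r * (4 * r ^ 2) ^ r ≤ lam →
        (∃ C : Set V, G.IsMinCut C ∧
          (G.cutSize C : ℝ) ≤ (r : ℝ) - Real.log ((lam : ℝ) / (4 * (r : ℝ))) / Real.log (n : ℝ)) ∨
        ((G.minCutEdges.ncard : ℝ) ≤
            K * ((r : ℝ) ^ (9 * r ^ 2 + 2) *
              (6 * (r : ℝ) ^ 2 / (lam : ℝ)) ^ ((1 : ℝ) / ((r : ℝ) - 1)) *
              (m : ℝ) * Real.log (n : ℝ)) ∧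
          (G.minCutEdges.ncard : ℝ) ≤
            h r * ((m : ℝ) / (lam : ℝ) ^ ((1 : ℝ) / ((r : ℝ) - 1))) * Real.log (n : ℝ) ^ k) := by
  -- The 20 is 10 · 2: (8r+2)r ≤ 10r², and log n ≥ 1/2 absorbs the logarithm. The function h
  -- collects all factors depending on r alone.
  refine ⟨20, fun r => 20 * r ^ (9 * r ^ 2 + 2) * (6 * (r : ℝ) ^ 2) ^ ((1 : ℝ) / ((r : ℝ) - 1)), 1,
    by norm_num, ?_⟩
  rintro V G r n m k hfin rfl rfl hr2 hr hconn hbig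
  obtain ⟨hn, h⟩ := G.exists_small_minCut_or_ncard_minCutEdges_le hfin hr2 hr hconn hbig
  set n := G.vertexSet.ncard
  set m := G.edgeSet.ncard
  have hk : 0 < k := lt_of_lt_of_le (by positivity) hbig
  have hkR : (0 : ℝ) < k := by exact_mod_cast hk
  have hr2R : (2 : ℝ) ≤ r := by exact_mod_cast hr2
  have hlog := Hypergraph.half_le_log_natCast hn
  refine h.imp ?_ fun h => ?_
  · rintro ⟨C, hC, hle, hpow⟩
    refine ⟨C, hC, ?_⟩
    have h1 : Real.log (k / (4 * r)) ≤ ((r : ℝ) - G.cutSize C) * Real.log n := by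
      rw [← Nat.cast_sub hle, ← Real.log_pow]
      refine Real.log_le_log (by positivity) ?_
      have h2 : (k : ℝ) ≤ 2 * (n : ℝ) ^ (r - G.cutSize C) := by exact_mod_cast hpow
      have h3 : (0 : ℝ) ≤ (n : ℝ) ^ (r - G.cutSize C) := by positivity
      rw [div_le_iff₀ (by positivity)]
      nlinarith
    have h2 := (div_le_iff₀ (by linarith : (0 : ℝ) < Real.log n)).2 h1
    linarith
  · set p : ℝ := 1 / ((r : ℝ) - 1) with hp
    have hp0 : 0 ≤ p := div_nonneg zero_le_one (by linarith)
    have hL : (((k : ℝ) / 2) ^ p) ^ (r - 1) = k / 2 := by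
      rw [← Real.rpow_natCast, ← Real.rpow_mul (by positivity), Nat.cast_sub (by omega),
        Nat.cast_one, hp, one_div_mul_cancel (by linarith), Real.rpow_one]
    have h0 := h _ (by positivity) hL
    have hU : (G.minCutEdges.ncard : ℝ) ≤ (8 * r + 2) * (r * m) * (2 / (k : ℝ)) ^ p := by
      rw [← inv_div (k : ℝ) 2, Real.inv_rpow (by positivity), ← div_eq_mul_inv,
        le_div_iff₀ (by positivity)]
      exact h0
    have hmono : (2 / (k : ℝ)) ^ p ≤ (6 * (r : ℝ) ^ 2 / k) ^ p := by
      refine Real.rpow_le_rpow (by positivity) ?_ hp0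
      exact div_le_div_of_nonneg_right (by nlinarith) hkR.le
    have hcoef : (8 * (r : ℝ) + 2) * r ≤ 10 * r ^ (9 * r ^ 2 + 2) := by
      have : (r : ℝ) ^ 2 ≤ r ^ (9 * r ^ 2 + 2) :=
        pow_le_pow_right₀ (by linarith) (by omega)
      nlinarith
    have hmain : (G.minCutEdges.ncard : ℝ) ≤ 20 * ((r : ℝ) ^ (9 * r ^ 2 + 2) *
        (6 * (r : ℝ) ^ 2 / k) ^ p * m * Real.log n) := by
      calc (G.minCutEdges.ncard : ℝ) ≤ (8 * r + 2) * (r * m) * (2 / (k : ℝ)) ^ p := hU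
        _ = (8 * r + 2) * r * (2 / (k : ℝ)) ^ p * m := by ring
        _ ≤ 10 * r ^ (9 * r ^ 2 + 2) * (6 * (r : ℝ) ^ 2 / k) ^ p * m := by gcongr
        _ = 20 * ((r : ℝ) ^ (9 * r ^ 2 + 2) * (6 * (r : ℝ) ^ 2 / k) ^ p * m * (1 / 2)) := by ring
        _ ≤ _ := by gcongr
    refine ⟨hmain, hmain.trans (le_of_eq ?_)⟩
    rw [Real.div_rpow (by positivity) hkR.le, pow_one]
    ring
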